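/- Let $\mathcal{E}$ be a qubit channel, i.e. a completely positive trace-preserving linear map on the $2\times 2$ complex matrices. A set $\mathcal{S}$ of channels from a system $Q$ to a system $Q'$ (all systems finite-dimensional) is called maskable if there are systems $A$, $B$, an isometry $M:\mathcal{H}_{Q'}\to\mathcal{H}_A\otimes\mathcal{H}_B$ (that is, $M^\dagger M=\mathbb{1}$), and channels $\alpha$ from $Q$ to $A$ and $\beta$ from $Q$ to $B$, such that for every $\mathcal{F}\in\mathcal{S}$ and every operator $X$ on $\mathcal{H}_Q$, $$\mathrm{Tr}_B[M\mathcal{F}(X)M^\dagger]=\alpha(X)\quad\text{and}\quad \mathrm{Tr}_A[M\mathcal{F}(X)M^\dagger]=\beta(X).$$ Then the set of qubit channels $\{\mathrm{id},\mathcal{E}\}$ is maskable if and only if $\mathcal{E}$ is unital, $\mathcal{E}(\mathbb{1})=\mathbb{1}$, and has a pure-state fixed point: there is a unit vector $|\psi\rangle\in\mathbb{C}^2$ with $\mathcal{E}(|\psi\rangle\langle\psi|)=|\psi\rangle\langle\psi|$. -/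

import Mathlib

noncomputable section Channels

open scoped CStarAlgebra MatrixOrder Matrix.Norms.L2Operator ComplexOrder

/-- A quantum channel from the system `ℂ^Q` to the system `ℂ^Q'`: a completely positive and
trace-preserving linear map between the matrix algebras (which are C⋆-algebras for the operator
norm, with the Loewner order as their order). -/
structure QuantumChannel (Q Q' : Type*) [Fintype Q] [DecidableEq Q] [Fintype Q']
    [DecidableEq Q'] where
  /-- the underlying completely positive map -/
  toCP : Matrix Q Q ℂ →CP Matrix Q' Q' ℂ
  trace_preserving : ∀ X : Matrix Q Q ℂ, (toCP X).trace = X.trace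

namespace QuantumChannel

variable {Q Q' : Type*} [Fintype Q] [DecidableEq Q] [Fintype Q'] [DecidableEq Q']

instance : CoeFun (QuantumChannel Q Q') (fun _ => Matrix Q Q ℂ → Matrix Q' Q' ℂ) :=
  ⟨fun E => E.toCP⟩

/-- The identity channel. -/
def id (Q : Type*) [Fintype Q] [DecidableEq Q] : QuantumChannel Q Q where
  toCP :=
    { toLinearMap := LinearMap.id
      map_cstarMatrix_nonneg' := fun _ _ hM => hM }
  trace_preserving := fun _ => rfl

@[simp] theorem id_apply (X : Matrix Q Q ℂ) : QuantumChannel.id Q X = X := rfl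

/-- A channel is unital if it maps the identity operator to the identity operator. -/
def IsUnital (E : QuantumChannel Q Q') : Prop :=
  E (1 : Matrix Q Q ℂ) = 1

end QuantumChannel

end Channels

/-- The rank-one operator `|ψ⟩⟨ψ|`; it is a pure state when `⟨ψ|ψ⟩ = 1`. -/
def ketBra {Q : Type*} (ψ : Q → ℂ) : Matrix Q Q ℂ :=
  Matrix.vecMulVec ψ (star ψ)

/-- Some pure state `|ψ⟩⟨ψ|`, with `ψ` a unit vector, is fixed by the channel. -/
def QuantumChannel.HasPureFixedPoint {Q : Type*} [Fintype Q] [DecidableEq Q]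
    (E : QuantumChannel Q Q) : Prop :=
  ∃ ψ : Q → ℂ, dotProduct (star ψ) ψ = 1 ∧ E (ketBra ψ) = ketBra ψ

/-- The partial trace `Tr_B` over the second tensor factor. -/
def partialTraceB {A B : Type*} [Fintype B] (X : Matrix (A × B) (A × B) ℂ) : Matrix A A ℂ :=
  Matrix.of fun a a' => ∑ b, X (a, b) (a', b)

/-- The partial trace `Tr_A` over the first tensor factor. -/
def partialTraceA {A B : Type*} [Fintype A] (X : Matrix (A × B) (A × B) ℂ) : Matrix B B ℂ :=
  Matrix.of fun b b' => ∑ a, X (a, b) (a, b')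

/-- A set `S` of channels with common input and output systems is maskable if there are a
bipartite system `A B` (with `A = ℂ^m` and `B = ℂ^n`), an isometry `M` from the output system to
`A B`, and two fixed channels `α` and `β` that are the reductions to `A` and to `B` of
`X ↦ M (E X) M†` for every `E` in `S`. -/
def IsMaskable {Q Q' : Type*} [Fintype Q] [DecidableEq Q] [Fintype Q'] [DecidableEq Q']
    (S : Set (QuantumChannel Q Q')) : Prop :=
  ∃ (m n : ℕ) (M : Matrix (Fin m × Fin n) Q' ℂ),
    M.conjTranspose * M = 1 ∧
    ∃ (α : QuantumChannel Q (Fin m)) (β : QuantumChannel Q (Fin n)),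
      ∀ E ∈ S, ∀ X : Matrix Q Q ℂ,
        partialTraceB (M * E X * M.conjTranspose) = α X ∧
        partialTraceA (M * E X * M.conjTranspose) = β X

/-! Each entry of a marginal of M X M† has the form Tr(H X), so masking id and E together means that
E preserves the expectations of all these H. Suppose E preserves some non-scalar Hermitian H. Since
E also preserves the trace, and a qubit has only two levels, E preserves the diagonal in an
eigenbasis of H. Positivity then fixes the eigenprojections (`fixed_of_diag`), hence their sum 1.
Otherwise every such H is scalar, and M would hide the whole qubit from both marginals, which
`no_masking` excludes. Conversely, a unital E fixing |ψ⟩⟨ψ| also fixes its complement, and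
positivity makes it preserve the diagonal in that basis (`diag_of_fixed`). Copying the basis, |i⟩ ↦
|i⟩|i⟩, leaves only this diagonal in either marginal. -/

section Pinching

open Matrix
open scoped CStarAlgebra MatrixOrder Matrix.Norms.L2Operator ComplexOrder

/-- The properties of a quantum channel on a qubit that are stable under a change of basis and
suffice here: linear, positive and trace preserving. -/
structure IsPositiveTP (T : Matrix (Fin 2) (Fin 2) ℂ →ₗ[ℂ] Matrix (Fin 2) (Fin 2) ℂ) : Prop where
  pos : ∀ X, X.PosSemidef → (T X).PosSemidef
  trace_eq : ∀ X, (T X).trace = X.trace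

theorem QuantumChannel.isPositiveTP (E : QuantumChannel (Fin 2) (Fin 2)) :
    IsPositiveTP E.toCP.toLinearMap where
  pos X hX := by
    have h : 0 ≤ E.toCP X := map_nonneg E.toCP hX.nonneg
    exact h.posSemidef
  trace_eq := E.trace_preserving

/-- The map `X ↦ U† T(U X U†) U`. -/
def conjMap (U : Matrix (Fin 2) (Fin 2) ℂ)
    (T : Matrix (Fin 2) (Fin 2) ℂ →ₗ[ℂ] Matrix (Fin 2) (Fin 2) ℂ) :
    Matrix (Fin 2) (Fin 2) ℂ →ₗ[ℂ] Matrix (Fin 2) (Fin 2) ℂ where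
  toFun X := Uᴴ * T (U * X * Uᴴ) * U
  map_add' X Y := by simp [mul_add, add_mul]
  map_smul' c X := by simp

theorem conjMap_apply (U : Matrix (Fin 2) (Fin 2) ℂ)
    (T : Matrix (Fin 2) (Fin 2) ℂ →ₗ[ℂ] Matrix (Fin 2) (Fin 2) ℂ) (X : Matrix (Fin 2) (Fin 2) ℂ) :
    conjMap U T X = Uᴴ * T (U * X * Uᴴ) * U := rfl

variable {U : Matrix (Fin 2) (Fin 2) ℂ}
  {T : Matrix (Fin 2) (Fin 2) ℂ →ₗ[ℂ] Matrix (Fin 2) (Fin 2) ℂ}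

theorem conj_conj_unitary (hU : U * Uᴴ = 1) (X : Matrix (Fin 2) (Fin 2) ℂ) :
    U * (Uᴴ * X * U) * Uᴴ = X := by
  calc _ = (U * Uᴴ) * X * (U * Uᴴ) := by noncomm_ring
    _ = X := by simp [hU]

/-- This lets both directions work in the standard basis. -/
theorem IsPositiveTP.conjMap (hT : IsPositiveTP T) (hU : U * Uᴴ = 1) :
    IsPositiveTP (conjMap U T) where
  pos X hX := (hT.pos _ (hX.mul_mul_conjTranspose_same U)).conjTranspose_mul_mul_same U
  trace_eq X := by
    rw [conjMap_apply, trace_mul_cycle, hU, one_mul, hT.trace_eq, trace_mul_cycle,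
      mul_eq_one_comm.mp hU, one_mul]

/-! ### Positivity and preservation of the diagonal -/

/-- A zero on the diagonal of a positive semidefinite matrix forces a zero column. -/
theorem Matrix.PosSemidef.col_eq_zero_of_diag_eq_zero {n : Type*} [Fintype n] [DecidableEq n]
    {A : Matrix n n ℂ} (hA : A.PosSemidef)
    {i : n} (hi : A i i = 0) (j : n) : A j i = 0 := by
  have h := (hA.dotProduct_mulVec_zero_iff (Pi.single i 1)).mp (by simp [hi])
  simpa using congrFun h j

/-- A zero on the diagonal of a positive semidefinite matrix forces a zero row. -/
theorem Matrix.PosSemidef.row_eq_zero_of_diag_eq_zero {n : Type*} [Fintype n] [DecidableEq n]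
    {A : Matrix n n ℂ} (hA : A.PosSemidef)
    {i : n} (hi : A i i = 0) (j : n) : A i j = 0 := by
  rw [← hA.isHermitian.apply i j, hA.col_eq_zero_of_diag_eq_zero hi, star_zero]

/-- A positive trace-preserving map that preserves the diagonal entries fixes the basis states. -/
theorem IsPositiveTP.fixed_of_diag (hT : IsPositiveTP T) (h : ∀ X i, T X i i = X i i) (d : Fin 2) :
    T (diagonal (Pi.single d 1)) = diagonal (Pi.single d 1) := by
  have hp : (T (diagonal (Pi.single d 1))).PosSemidef :=
    hT.pos _ (PosSemidef.diagonal (Pi.single_nonneg.mpr zero_le_one))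
  have key : ∀ i j, i ≠ j → T (diagonal (Pi.single d 1)) i j = 0 := by
    intro i j hij
    by_cases hi : i = d
    · have hj : j ≠ d := fun hj => hij (hi.trans hj.symm)
      exact hp.col_eq_zero_of_diag_eq_zero (by simp [h, hj]) i
    · exact hp.row_eq_zero_of_diag_eq_zero (by simp [h, hi]) j
  ext i j
  by_cases hij : i = j
  · subst hij; rw [h]
  · rw [key i j hij, diagonal_apply_ne _ hij]

/-- A quadratic form that is nonnegative and has no constant term has no linear term. -/
theorem eq_zero_of_quadratic_nonneg {p q : ℂ}
    (h : ∀ y : ℂ, 0 ≤ star y * p + y * q + star y * y) : p = 0 ∧ q = 0 := by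
  have h1 := (Complex.le_def.mp (h 1))
  have h2 := (Complex.le_def.mp (h Complex.I))
  -- These two points minimize the real part along the real and the imaginary axis.
  have h3 := (Complex.le_def.mp (h (-((p.re + q.re) / 2 : ℝ))))
  have h4 := (Complex.le_def.mp (h (-((p.im - q.im) / 2 : ℝ) * Complex.I)))
  simp at h1 h2 h3 h4
  have e1 : p.re + q.re = 0 := by nlinarith
  have e2 : p.im - q.im = 0 := by nlinarith
  constructor <;> apply Complex.ext <;> simp <;> linarith [h1.2, h2.2]

/-- A positive unital trace-preserving map that fixes a basis state preserves the diagonal. -/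
theorem IsPositiveTP.diag_of_fixed (hT : IsPositiveTP T) (h1 : T 1 = 1)
    (h0 : T (diagonal (Pi.single 0 1)) = diagonal (Pi.single 0 1))
    (X : Matrix (Fin 2) (Fin 2) ℂ) (i : Fin 2) : T X i i = X i i := by
  have hd : T (diagonal (Pi.single 1 1)) = diagonal (Pi.single 1 1) := by
    have : (diagonal (Pi.single 1 1) : Matrix (Fin 2) (Fin 2) ℂ) = 1 - diagonal (Pi.single 0 1) := by
      ext i j; fin_cases i <;> fin_cases j <;> simp
    rw [this, map_sub, h1, h0]
  have decomp : ∀ X : Matrix (Fin 2) (Fin 2) ℂ, X = X 0 0 • diagonal (Pi.single 0 1)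
      + X 0 1 • single 0 1 1 + X 1 0 • single 1 0 1 + X 1 1 • diagonal (Pi.single 1 1) := by
    intro X
    ext i j; fin_cases i <;> fin_cases j <;> simp
  have val : ∀ X : Matrix (Fin 2) (Fin 2) ℂ, T X 1 1 =
      X 0 1 * T (single 0 1 1) 1 1 + X 1 0 * T (single 1 0 1) 1 1 + X 1 1 := by
    intro X
    conv_lhs => rw [decomp X]
    simp [h0, hd, -smul_single]
  -- For v = (1, y), the last diagonal entry of T(vv†) is a nonnegative quadratic in y; it has no
  -- constant term because T fixes the first basis state.
  have hz := eq_zero_of_quadratic_nonneg (p := T (single 0 1 1) 1 1) (q := T (single 1 0 1) 1 1)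
    (by
      intro y
      have := (hT.pos _ (posSemidef_vecMulVec_self_star ![1, y])).diag_nonneg (i := 1)
      rw [val] at this
      simpa [vecMulVec_apply, mul_comm] using this)
  have e1 : T X 1 1 = X 1 1 := by rw [val, hz.1, hz.2]; simp
  have ht := hT.trace_eq X
  rw [trace_fin_two, trace_fin_two, e1] at ht
  fin_cases i
  · simpa using ht
  · exact e1

end Pinching

section Masking

open Matrix
open scoped CStarAlgebra MatrixOrder Matrix.Norms.L2Operator ComplexOrder

/-! ### Kraus channels and the copying masker -/

/-- The completely positive map `X ↦ ∑ d, K_d† X K_d`. -/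
def krausCP {A ι : Type*} [CStarAlgebra A] [PartialOrder A] [StarOrderedRing A] [Fintype ι]
    (K : ι → A) : A →CP A where
  toFun X := ∑ d, star (K d) * X * K d
  map_add' X Y := by simp [mul_add, add_mul, Finset.sum_add_distrib]
  map_smul' c X := by simp [Finset.smul_sum]
  map_cstarMatrix_nonneg' k M hM := by
    let f : CStarMatrix (Fin k) (Fin k) A →+ CStarMatrix (Fin k) (Fin k) A :=
      { toFun N := N.map fun X => ∑ d, star (K d) * X * K d
        map_zero' := by ext; simp
        map_add' N N' := by ext; simp [mul_add, add_mul, Finset.sum_add_distrib] }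
    -- Nonnegative elements are sums of terms x†x, and applying the map entrywise to x†x gives a sum
    -- of squares y_d†y_d with y_d = (x_ij K_d).
    rw [StarOrderedRing.nonneg_iff] at hM
    change 0 ≤ f M
    induction hM using AddSubmonoid.closure_induction with
    | zero => rw [map_zero]
    | add N N' _ _ hN hN' => rw [map_add]; exact add_nonneg hN hN'
    | mem N hN =>
      obtain ⟨x, rfl⟩ := hN
      let y : ι → CStarMatrix (Fin k) (Fin k) A :=
        fun d => CStarMatrix.ofMatrix (of fun i j => x i j * K d)
      have h : f (star x * x) = ∑ d, star (y d) * y d := by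
        have happ : ∀ (s : Finset ι) (g : ι → CStarMatrix (Fin k) (Fin k) A) i j,
            (∑ d ∈ s, g d) i j = ∑ d ∈ s, g d i j := by
          intro s g i j
          exact map_sum (⟨⟨fun N : CStarMatrix (Fin k) (Fin k) A => N i j, rfl⟩,
            fun _ _ => rfl⟩ : CStarMatrix (Fin k) (Fin k) A →+ A) g s
        apply CStarMatrix.ext
        intro i j
        rw [happ]
        change ∑ d, star (K d) * (star x * x) i j * K d = _
        refine Finset.sum_congr rfl fun d _ => ?_
        rw [CStarMatrix.mul_apply, CStarMatrix.mul_apply, Finset.mul_sum, Finset.sum_mul]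
        refine Finset.sum_congr rfl fun l _ => ?_
        simp only [CStarMatrix.star_apply, y, CStarMatrix.ofMatrix_apply, of_apply, star_mul,
          mul_assoc]
      rw [h]
      exact Finset.sum_nonneg fun d _ => star_mul_self_nonneg (y d)

/-- The channel with Kraus operators `K_d†`. -/
noncomputable def krausChannel {Q ι : Type*} [Fintype Q] [DecidableEq Q] [Fintype ι]
    (K : ι → Matrix Q Q ℂ) (hK : ∑ d, K d * (K d)ᴴ = 1) : QuantumChannel Q Q where
  toCP := krausCP K
  trace_preserving X := by
    change (∑ d, (K d)ᴴ * X * K d).trace = X.trace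
    simp only [trace_sum, fun d => trace_mul_cycle (K d)ᴴ X (K d)]
    rw [← trace_sum, ← Finset.sum_mul, hK, one_mul]

theorem krausChannel_apply {Q ι : Type*} [Fintype Q] [DecidableEq Q] [Fintype ι]
    (K : ι → Matrix Q Q ℂ) (hK : ∑ d, K d * (K d)ᴴ = 1) (X : Matrix Q Q ℂ) :
    krausChannel K hK X = ∑ d, (K d)ᴴ * X * K d := rfl

variable {U : Matrix (Fin 2) (Fin 2) ℂ}

/-- The masker sending the `i`-th column of `U` to `|i⟩|i⟩`. -/
noncomputable def copyIsometry (U : Matrix (Fin 2) (Fin 2) ℂ) :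
    Matrix (Fin 2 × Fin 2) (Fin 2) ℂ :=
  of fun p j => if p.1 = p.2 then Uᴴ p.1 j else 0

theorem copyIsometry_isometry (hU : U * Uᴴ = 1) :
    (copyIsometry U)ᴴ * copyIsometry U = 1 := by
  rw [← hU]
  ext i j
  simp [copyIsometry, mul_apply, Fintype.sum_prod_type]

theorem copyIsometry_conj_apply (X : Matrix (Fin 2) (Fin 2) ℂ) (p q : Fin 2 × Fin 2) :
    (copyIsometry U * X * (copyIsometry U)ᴴ) p q =
      if p.1 = p.2 ∧ q.1 = q.2 then (Uᴴ * X * U) p.1 q.1 else 0 := by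
  by_cases hp : p.1 = p.2 <;> by_cases hq : q.1 = q.2 <;>
    simp [copyIsometry, mul_apply, hp, hq]

theorem partialTraceB_copyIsometry (X : Matrix (Fin 2) (Fin 2) ℂ) :
    partialTraceB (copyIsometry U * X * (copyIsometry U)ᴴ) =
      diagonal fun i => (Uᴴ * X * U) i i := by
  ext i j
  simp only [partialTraceB, of_apply, copyIsometry_conj_apply]
  fin_cases i <;> fin_cases j <;> simp

theorem partialTraceA_copyIsometry (X : Matrix (Fin 2) (Fin 2) ℂ) :
    partialTraceA (copyIsometry U * X * (copyIsometry U)ᴴ) =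
      diagonal fun i => (Uᴴ * X * U) i i := by
  ext i j
  simp only [partialTraceA, of_apply, copyIsometry_conj_apply]
  fin_cases i <;> fin_cases j <;> simp

/-- Normalization of the Kraus operators of the measurement in the basis of the columns of `U`. -/
theorem sum_measurement (hU : U * Uᴴ = 1) :
    ∑ d, (U * diagonal (Pi.single d 1)) * (U * diagonal (Pi.single d 1))ᴴ = 1 := by
  rw [← hU]
  ext i j
  simp [mul_apply, Fin.sum_univ_two, diagonal_apply]

/-- Exhibits the common marginal of the copying masker as a genuine channel. -/
theorem krausChannel_measurement (hU : U * Uᴴ = 1) (X : Matrix (Fin 2) (Fin 2) ℂ) :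
    krausChannel _ (sum_measurement hU) X = diagonal fun i => (Uᴴ * X * U) i i := by
  rw [krausChannel_apply]
  have h : ∀ d : Fin 2, (U * diagonal (Pi.single d 1))ᴴ * X * (U * diagonal (Pi.single d 1)) =
      diagonal (Pi.single d 1) * (Uᴴ * X * U) * diagonal (Pi.single d 1) := by
    intro d
    have hs : (diagonal (Pi.single d 1) : Matrix (Fin 2) (Fin 2) ℂ)ᴴ =
        diagonal (Pi.single d 1) := by
      simp [diagonal_conjTranspose]
    rw [conjTranspose_mul, hs]
    noncomm_ring
  simp only [h]
  ext i j
  fin_cases i <;> fin_cases j <;> simp [Fin.sum_univ_two]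

/-- Channels that agree on the diagonal in an orthonormal basis are masked together. -/
theorem isMaskable_of_diag (hU : U * Uᴴ = 1) {S : Set (QuantumChannel (Fin 2) (Fin 2))}
    (hS : ∀ E ∈ S, ∀ X i, (Uᴴ * E X * U) i i = (Uᴴ * X * U) i i) : IsMaskable S := by
  refine ⟨2, 2, copyIsometry U, copyIsometry_isometry hU, krausChannel _ (sum_measurement hU),
    krausChannel _ (sum_measurement hU), fun E hE X => ?_⟩
  rw [partialTraceA_copyIsometry, partialTraceB_copyIsometry, krausChannel_measurement hU]
  simp only [hS E hE X, and_self]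

/-- A qubit pure state is the first vector of an orthonormal basis. -/
theorem exists_unitary_ketBra {ψ : Fin 2 → ℂ} (hψ : dotProduct (star ψ) ψ = 1) :
    ∃ U : Matrix (Fin 2) (Fin 2) ℂ, U * Uᴴ = 1 ∧
      U * diagonal (Pi.single 0 1) * Uᴴ = ketBra ψ := by
  refine ⟨!![ψ 0, -star (ψ 1); ψ 1, star (ψ 0)], ?_, ?_⟩
  · rw [mul_eq_one_comm]
    simp [dotProduct] at hψ
    ext i j
    fin_cases i <;> fin_cases j <;> simp [mul_apply, Fin.sum_univ_two] <;>
      first | linear_combination hψ | ring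
  · ext i j
    fin_cases i <;> fin_cases j <;>
      simp [mul_apply, Fin.sum_univ_two, ketBra, vecMulVec_apply, vecMul_diagonal]

theorem isMaskable_of_unital_of_hasPureFixedPoint {E : QuantumChannel (Fin 2) (Fin 2)}
    (h1 : E.IsUnital) (h : E.HasPureFixedPoint) :
    IsMaskable {QuantumChannel.id (Fin 2), E} := by
  obtain ⟨ψ, hψ, hE⟩ := h
  obtain ⟨U, hU, hUψ⟩ := exists_unitary_ketBra hψ
  have hU' : Uᴴ * U = 1 := mul_eq_one_comm.mp hU
  have hUc (X : Matrix (Fin 2) (Fin 2) ℂ) : Uᴴ * (U * X * Uᴴ) * U = X := by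
    simpa using conj_conj_unitary (U := Uᴴ) (by simpa using hU') X
  refine isMaskable_of_diag hU ?_
  rintro F (rfl | rfl) X i
  · rfl
  · have key := (F.isPositiveTP.conjMap hU).diag_of_fixed ?_ ?_ (Uᴴ * X * U) i
    · rw [conjMap_apply, conj_conj_unitary hU] at key
      exact key
    · rw [conjMap_apply, mul_one, hU]
      change Uᴴ * F 1 * U = 1
      rw [h1, mul_one, hU']
    · rw [conjMap_apply, hUψ]
      change Uᴴ * F (ketBra ψ) * U = _
      rw [hE, ← hUψ, hUc]

/-! ### Necessity: preserved observables and no masking -/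

/-- A qubit channel that preserves the expectation values of a non-scalar Hermitian observable is
unital and has a pure-state fixed point. -/
theorem unital_and_pureFixedPoint_of_observable {E : QuantumChannel (Fin 2) (Fin 2)}
    {H : Matrix (Fin 2) (Fin 2) ℂ} (hH : H.IsHermitian) (hs : ∀ c : ℂ, H ≠ scalar (Fin 2) c)
    (hE : ∀ X, (H * E X).trace = (H * X).trace) : E.IsUnital ∧ E.HasPureFixedPoint := by
  set U : Matrix (Fin 2) (Fin 2) ℂ := ↑hH.eigenvectorUnitary
  have hU : U * Uᴴ = 1 := Unitary.coe_mul_star_self hH.eigenvectorUnitary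
  have hU' : Uᴴ * U = 1 := mul_eq_one_comm.mp hU
  set a : Fin 2 → ℂ := fun i => hH.eigenvalues i with ha
  have hsp : H = U * diagonal a * Uᴴ := by
    have := hH.spectral_theorem
    rw [Unitary.conjStarAlgAut_apply] at this
    exact this
  have hne : a 0 - a 1 ≠ 0 := by
    intro h0
    apply hs (a 0)
    have : diagonal a = a 0 • (1 : Matrix (Fin 2) (Fin 2) ℂ) := by
      ext i j; fin_cases i <;> fin_cases j <;> simp [sub_eq_zero.mp h0]
    rw [hsp, this, mul_smul_comm, mul_one, smul_mul_assoc, hU, scalar_apply, smul_one_eq_diagonal]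
  have hT := E.isPositiveTP.conjMap hU
  set T := conjMap U E.toCP.toLinearMap with hTdef
  have hinv : ∀ X, (diagonal a * T X).trace = (diagonal a * X).trace := by
    intro X
    have h := hE (U * X * Uᴴ)
    have e : ∀ Y, (H * Y).trace = (diagonal a * (Uᴴ * Y * U)).trace := by
      intro Y
      rw [hsp, show U * diagonal a * Uᴴ * Y = U * (diagonal a * Uᴴ * Y) by noncomm_ring,
        trace_mul_comm]
      congr 1
      noncomm_ring
    rw [e, e, show Uᴴ * (U * X * Uᴴ) * U = (Uᴴ * U) * X * (Uᴴ * U) by noncomm_ring, hU', one_mul,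
      mul_one] at h
    exact h
  have hdiag : ∀ X i, T X i i = X i i := by
    intro X
    have h1 := hinv X
    have h2 := hT.trace_eq X
    simp only [trace_fin_two, diagonal_mul] at h1 h2
    -- Subtracting a 1 times the trace identity leaves only the first entry, with the nonzero factor
    -- a 0 - a 1.
    have e0 : T X 0 0 = X 0 0 := by
      apply mul_left_cancel₀ hne
      linear_combination h1 - a 1 * h2
    rw [Fin.forall_fin_two]
    exact ⟨e0, by linear_combination h2 - e0⟩
  have hfix := hT.fixed_of_diag hdiag
  have back : ∀ X, T X = X → E (U * X * Uᴴ) = U * X * Uᴴ := by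
    intro X hX
    have h := congrArg (fun Y => U * Y * Uᴴ) hX
    simp only [hTdef, conjMap_apply, conj_conj_unitary hU] at h
    exact h
  constructor
  · have h1 : T 1 = 1 := by
      have : (1 : Matrix (Fin 2) (Fin 2) ℂ) =
          diagonal (Pi.single 0 1) + diagonal (Pi.single 1 1) := by
        ext i j; fin_cases i <;> fin_cases j <;> simp
      rw [this, map_add, hfix, hfix]
    have h := back 1 h1
    rwa [mul_one, hU] at h
  · have hk : U * diagonal (Pi.single 0 1) * Uᴴ = ketBra (fun i => U i 0) := by
      ext i j
      simp [mul_apply, ketBra, vecMulVec_apply, Fin.sum_univ_two, diagonal_apply]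
    refine ⟨fun i => U i 0, ?_, ?_⟩
    · have := congrFun (congrFun hU' 0) 0
      simpa [mul_apply, dotProduct] using this
    · rw [← hk]
      exact back _ (hfix 0)

/-- If the Hermitian elements of a subspace are scalar, so is every element whose adjoint lies in
the subspace. -/
theorem scalar_of_hermitian_scalar {n : Type*} [Fintype n] [DecidableEq n]
    {W : Submodule ℂ (Matrix n n ℂ)}
    (hW : ∀ H ∈ W, H.IsHermitian → ∃ c : ℂ, H = scalar n c) {H : Matrix n n ℂ}
    (h : H ∈ W) (h' : Hᴴ ∈ W) : ∃ c : ℂ, H = scalar n c := by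
  obtain ⟨c, hc⟩ := hW (H + Hᴴ) (W.add_mem h h') (isHermitian_add_transpose_self H)
  obtain ⟨d, hd⟩ := hW (Complex.I • (H - Hᴴ)) (W.smul_mem _ (W.sub_mem h h')) (by
    simp [IsHermitian, conjTranspose_smul, ← smul_neg])
  refine ⟨(c - Complex.I * d) / 2, ?_⟩
  have e : H = (1 / 2 : ℂ) • ((H + Hᴴ) - Complex.I • (Complex.I • (H - Hᴴ))) := by
    rw [smul_smul, Complex.I_mul_I]
    module
  rw [e, hc, hd]
  ext i j
  by_cases hij : i = j
  · subst hij; simp; ring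
  · simp [hij]

/-- The observables whose expectation values are preserved by `E`. -/
def preservedObservables (E : QuantumChannel (Fin 2) (Fin 2)) :
    Submodule ℂ (Matrix (Fin 2) (Fin 2) ℂ) where
  carrier := {H | ∀ X, (H * E X).trace = (H * X).trace}
  add_mem' h h' X := by simp [add_mul, h X, h' X]
  zero_mem' X := by simp
  smul_mem' c H h X := by simp [h X]

/-- **No masking**: no isometry hides all qubit states in its marginals. Here `V i` is the
coefficient matrix of the image of the `i`-th basis vector. -/
theorem no_masking {m n : Type*} [Fintype m] [Fintype n]
    {V : Fin 2 → Matrix m n ℂ}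
    (hB : V 0 * (V 1)ᴴ = 0 ∧ V 0 * (V 0)ᴴ = V 1 * (V 1)ᴴ)
    (hA : (V 0)ᴴ * V 0 = (V 1)ᴴ * V 1) : V 0 = 0 := by
  -- V₀V₀†V₀ = V₀V₁†V₁ = 0, and V₀V₀†V₀ vanishes only if V₀ does.
  rw [← conjTranspose_mul_self_eq_zero, ← self_mul_conjTranspose_mul_eq_zero, Matrix.mul_assoc,
    hA, ← Matrix.mul_assoc, hB.1, Matrix.zero_mul]

theorem unital_and_pureFixedPoint_of_isMaskable {E : QuantumChannel (Fin 2) (Fin 2)}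
    (h : IsMaskable {QuantumChannel.id (Fin 2), E}) : E.IsUnital ∧ E.HasPureFixedPoint := by
  obtain ⟨m, n, M, hM, α, β, hαβ⟩ := h
  by_contra hcon
  have hscal : ∀ H ∈ preservedObservables E, H.IsHermitian → ∃ c : ℂ, H = scalar (Fin 2) c := by
    intro H hH hHerm
    by_contra hs
    push Not at hs
    exact hcon (unital_and_pureFixedPoint_of_observable hHerm hs hH)
  have hid := hαβ (QuantumChannel.id (Fin 2)) (by simp)
  have hE := hαβ E (by simp)
  let V : Fin 2 → Matrix (Fin m) (Fin n) ℂ := fun i => of fun a b => M (a, b) i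
  -- The observables reading off the marginal entries; the indices are swapped because Tr(HX) pairs
  -- H j i with X i j.
  let HB : Fin m → Fin m → Matrix (Fin 2) (Fin 2) ℂ :=
    fun a a' => of fun j i => (V i * (V j)ᴴ) a a'
  let HA : Fin n → Fin n → Matrix (Fin 2) (Fin 2) ℂ :=
    fun b b' => of fun j i => ((V j)ᴴ * V i) b' b
  have trB : ∀ a a' X, (HB a a' * X).trace =
      partialTraceB (M * X * Mᴴ) a a' := by
    intro a a' X
    simp only [trace_fin_two, mul_apply, Fin.sum_univ_two, HB, V, of_apply, partialTraceB,
      conjTranspose_apply, Finset.sum_mul, ← Finset.sum_add_distrib]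
    refine Finset.sum_congr rfl fun _ _ => ?_
    ring
  have trA : ∀ b b' X, (HA b b' * X).trace =
      partialTraceA (M * X * Mᴴ) b b' := by
    intro b b' X
    simp only [trace_fin_two, mul_apply, Fin.sum_univ_two, HA, V, of_apply, partialTraceA,
      conjTranspose_apply, Finset.sum_mul, ← Finset.sum_add_distrib]
    refine Finset.sum_congr rfl fun _ _ => ?_
    ring
  have memB : ∀ a a', HB a a' ∈ preservedObservables E := fun a a' X => by
    rw [trB, trB, (hE X).1]
    exact congrFun (congrFun (hid X).1.symm a) a'
  have memA : ∀ b b', HA b b' ∈ preservedObservables E := fun b b' X => by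
    rw [trA, trA, (hE X).2]
    exact congrFun (congrFun (hid X).2.symm b) b'
  have starB : ∀ a a', (HB a a')ᴴ = HB a' a := fun a a' => by
    ext i j
    simp [HB, mul_apply, mul_comm]
  have starA : ∀ b b', (HA b b')ᴴ = HA b' b := fun b b' => by
    ext i j
    simp [HA, mul_apply, mul_comm]
  -- A single `HB a a'` need not be Hermitian, but its adjoint `HB a' a` is also preserved.
  have scalB := fun a a' => scalar_of_hermitian_scalar hscal (memB a a') (starB a a' ▸ memB a' a)
  have scalA := fun b b' => scalar_of_hermitian_scalar hscal (memA b b') (starA b b' ▸ memA b' b)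
  have hV : V 0 = 0 := by
    refine no_masking ⟨?_, ?_⟩ ?_
    · ext a a'
      obtain ⟨c, hc⟩ := scalB a a'
      simpa [HB] using congrFun (congrFun hc 1) 0
    · ext a a'
      obtain ⟨c, hc⟩ := scalB a a'
      have h0 := congrFun (congrFun hc 0) 0
      have h1 := congrFun (congrFun hc 1) 1
      simp only [HB, of_apply, scalar_apply, diagonal_apply_eq] at h0 h1
      rw [h0, h1]
    · ext b' b
      obtain ⟨c, hc⟩ := scalA b b'
      have h0 := congrFun (congrFun hc 0) 0
      have h1 := congrFun (congrFun hc 1) 1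
      simp only [HA, of_apply, scalar_apply, diagonal_apply_eq] at h0 h1
      rw [h0, h1]
  have hcol : ∀ p, M p 0 = 0 := fun p => congrFun (congrFun hV p.1) p.2
  have h00 := congrFun (congrFun hM 0) 0
  simp [mul_apply, hcol] at h00

end Masking

/-- The pair consisting of the identity channel and a qubit channel `E` can be masked if and only
if `E` is unital and has a pure-state fixed point. -/
theorem theorem3 (E : QuantumChannel (Fin 2) (Fin 2)) :
    IsMaskable {QuantumChannel.id (Fin 2), E} ↔ E.IsUnital ∧ E.HasPureFixedPoint :=
  ⟨unital_and_pureFixedPoint_of_isMaskable,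
    fun h => isMaskable_of_unital_of_hasPureFixedPoint h.1 h.2⟩
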